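/- Let $d$ be an odd positive integer. An arrangement of $n$ hyperplanes in $\mathbb{R}^d$ is an indexed family $H_1,\dots,H_n$ of $(d-1)$-dimensional affine subspaces of $\mathbb{R}^d$. It is simple if, for $0\le k\le d$, any $k$ of the hyperplanes intersect in an affine subspace of dimension $d-k$, and any $d+1$ or more of them have empty intersection. Its topes are the connected components of $\mathbb{R}^d\setminus\bigcup_i H_i$. Its tope graph has the topes as vertices, two topes being adjacent if the intersection of their closures is a facet of each of the two closures. A 2-colouring of the tope graph is an assignment of one of two colours, burnt umber and chartreuse, to each tope such that adjacent topes receive different colours; $b$ and $c$ denote the numbers of topes coloured burnt umber and chartreuse, respectively. (i) For every $\varepsilon>0$ there is an integer $N$, depending only on $d$ and $\varepsilon$, such that for every $n\ge N$, every simple arrangement of $n$ hyperplanes in $\mathbb{R}^d$ and every 2-colouring of its tope graph, the number of topes is finite, $c>0$, and $$\frac{b}{c}\le 1+\varepsilon .$$ (ii) Consequently $$\limsup_{n\to\infty}\ \sup\frac{b}{c}=1,$$ where, for each $n$, the supremum (in $[0,\infty]$) is over all simple arrangements of $n$ hyperplanes in $\mathbb{R}^d$ and all 2-colourings of their tope graphs.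 -/

import Mathlib

open scoped ENNReal

/-- An arrangement of `n` hyperplanes in `ℝ^d`: an indexed family of
`(d - 1)`-dimensional affine subspaces. -/
structure HyperplaneArrangement (d n : ℕ) where
  /-- The hyperplanes of the arrangement. -/
  hyperplane : Fin n → AffineSubspace ℝ (EuclideanSpace ℝ (Fin d))
  nonempty : ∀ i, (hyperplane i : Set (EuclideanSpace ℝ (Fin d))).Nonempty
  finrank_direction : ∀ i, Module.finrank ℝ (hyperplane i).direction + 1 = d

/-- `F` is a facet of the closed polyhedron `P` in `ℝ^d`: a nonempty face (the set of points of `P`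
at which some linear functional attains its maximum over `P`) of dimension `d - 1`. -/
def IsFacet {d : ℕ} (P F : Set (EuclideanSpace ℝ (Fin d))) : Prop :=
  F.Nonempty ∧ IsExposed ℝ P F ∧ Module.finrank ℝ (affineSpan ℝ F).direction + 1 = d

namespace HyperplaneArrangement

variable {d n : ℕ}

/-- An arrangement is simple if, for `0 ≤ k ≤ d`, any `k` of the hyperplanes meet in an affine
subspace of dimension `d - k`, and any `d + 1` or more of them have empty intersection. -/
def IsSimple (A : HyperplaneArrangement d n) : Prop :=
  (∀ S : Finset (Fin n), S.card ≤ d →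
    (⋂ i ∈ S, (A.hyperplane i : Set (EuclideanSpace ℝ (Fin d)))).Nonempty ∧
    Module.finrank ℝ (⨅ i ∈ S, A.hyperplane i).direction + S.card = d) ∧
  (∀ S : Finset (Fin n), d < S.card →
    (⋂ i ∈ S, (A.hyperplane i : Set (EuclideanSpace ℝ (Fin d)))) = ∅)

/-- The complement of the union of the hyperplanes. -/
def complement (A : HyperplaneArrangement d n) : Set (EuclideanSpace ℝ (Fin d)) :=
  (⋃ i, (A.hyperplane i : Set (EuclideanSpace ℝ (Fin d))))ᶜ

/-- The topes: the connected components of the complement of the union of the hyperplanes. -/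
def topes (A : HyperplaneArrangement d n) : Set (Set (EuclideanSpace ℝ (Fin d))) :=
  {T | ∃ x ∈ A.complement, T = connectedComponentIn A.complement x}

/-- The tope graph: two topes are adjacent if the intersection of their closures is a facet
of each of these closures. -/
def topeGraph (A : HyperplaneArrangement d n) : SimpleGraph A.topes where
  Adj T T' := T ≠ T' ∧
    IsFacet (closure (T : Set (EuclideanSpace ℝ (Fin d)))) (closure T.1 ∩ closure T'.1) ∧
    IsFacet (closure (T' : Set (EuclideanSpace ℝ (Fin d)))) (closure T.1 ∩ closure T'.1)
  symm := ⟨fun T T' h => by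
    rw [Set.inter_comm (closure T'.1)]
    exact ⟨h.1.symm, h.2.2, h.2.1⟩⟩
  loopless := ⟨fun _ h => h.1 rfl⟩

/-- The number of topes that receive the colour `k` in a proper 2-colouring of the tope graph. -/
noncomputable def numTopes (A : HyperplaneArrangement d n) (C : A.topeGraph.Coloring Bool)
    (k : Bool) : ℕ :=
  (C.colorClass k).ncard

end HyperplaneArrangement

/-- The supremum in `[0, ∞]` of the ratios `b / c`, over all simple arrangements of `n` hyperplanes
in `ℝ^d` and all proper 2-colourings of their tope graphs, where `b` and `c` are the numbers of
topes of the two colours. -/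
noncomputable def supTopeRatio (d n : ℕ) : ℝ≥0∞ :=
  ⨆ (A : HyperplaneArrangement d n) (_ : A.IsSimple) (C : A.topeGraph.Coloring Bool),
    (A.numTopes C true : ℝ≥0∞) / (A.numTopes C false : ℝ≥0∞)

/-! Each hyperplane is the zero set of an affine form, and topes correspond to the sign patterns
realised by these forms. The ratio is controlled by bounding the total number of topes above and
each colour class below, with the same leading term. Upper bound: realised patterns shatter no set
of more than `d` indices (`card_le_of_shatters`), so Sauer–Shelah gives at most `∑ k ≤ d, n.choose
k` topes. Lower bound: every `d`-set `I` of hyperplanes determines a vertex. A generic linear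
functional picks out one cell at that vertex on which it is minimised there, and the opposite cell,
on which it is maximised there. A cell has at most one such minimising vertex and one such
maximising vertex, so both assignments are injective in `I`. Opposite cells are separated by exactly
`d` walls, so for odd `d` their colours differ; hence each colour has at least `n.choose d / 2`
topes (`IsSimple.choose_le_two_mul_card`). Together these give `b ≤ c + ∑ k < d, n.choose k`, and
the sum is negligible against `n.choose d ≤ 2 * c`. For the limsup, the ratio is also at least `1`
for some arrangement and colouring: moment-curve hyperplanes are simple, parity of signs is a
2-colouring, and the colours may be exchanged. -/

theorem AffineSubspace.exists_normal {d : ℕ} (H : AffineSubspace ℝ (EuclideanSpace ℝ (Fin d)))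
    (hne : (H : Set (EuclideanSpace ℝ (Fin d))).Nonempty)
    (hH : Module.finrank ℝ H.direction + 1 = d) :
    ∃ (a : EuclideanSpace ℝ (Fin d)) (t : ℝ), ∀ x, x ∈ H ↔ inner ℝ a x = t := by
  obtain ⟨p, hp⟩ := hne
  have h1 : Module.finrank ℝ H.directionᗮ = 1 := by
    have := H.direction.finrank_add_finrank_orthogonal
    rw [finrank_euclideanSpace_fin] at this
    omega
  obtain ⟨a, -, hspan⟩ := finrank_eq_one_iff'.1 h1
  refine ⟨a, inner ℝ (a : EuclideanSpace ℝ (Fin d)) p, fun x => ?_⟩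
  have hmem : x -ᵥ p ∈ H.direction ↔ ∀ u ∈ H.directionᗮ, inner ℝ u (x -ᵥ p) = 0 := by
    rw [← Submodule.mem_orthogonal, H.direction.orthogonal_orthogonal]
  rw [← AffineSubspace.vsub_right_mem_direction_iff_mem hp, hmem]
  have hsub : inner ℝ (a : EuclideanSpace ℝ (Fin d)) (x -ᵥ p) = 0 ↔
      inner ℝ (a : EuclideanSpace ℝ (Fin d)) x = inner ℝ (a : EuclideanSpace ℝ (Fin d)) p := by
    rw [vsub_eq_sub, inner_sub_right, sub_eq_zero]
  rw [← hsub]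
  refine ⟨fun h => h a a.2, fun h u hu => ?_⟩
  obtain ⟨c, hc⟩ := hspan ⟨u, hu⟩
  have : u = c • (a : EuclideanSpace ℝ (Fin d)) := by simpa using (congrArg Subtype.val hc).symm
  rw [this, real_inner_smul_left, h, mul_zero]

namespace HyperplaneArrangement

variable {d n : ℕ} (A : HyperplaneArrangement d n)

/-- A normal vector of the `i`-th hyperplane. -/
noncomputable def normal (i : Fin n) : EuclideanSpace ℝ (Fin d) :=
  ((A.hyperplane i).exists_normal (A.nonempty i) (A.finrank_direction i)).choose

/-- An affine function vanishing exactly on the `i`-th hyperplane. -/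
noncomputable def form (i : Fin n) (x : EuclideanSpace ℝ (Fin d)) : ℝ :=
  inner ℝ (A.normal i) x -
    ((A.hyperplane i).exists_normal (A.nonempty i) (A.finrank_direction i)).choose_spec.choose

variable {A}

theorem mem_hyperplane_iff {i : Fin n} {x : EuclideanSpace ℝ (Fin d)} :
    x ∈ A.hyperplane i ↔ A.form i x = 0 := by
  rw [form, sub_eq_zero]
  exact ((A.hyperplane i).exists_normal (A.nonempty i)
    (A.finrank_direction i)).choose_spec.choose_spec x

theorem form_add (i : Fin n) (x v : EuclideanSpace ℝ (Fin d)) :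
    A.form i (x + v) = A.form i x + inner ℝ (A.normal i) v := by
  simp only [form, inner_add_right]; ring

theorem form_combo (i : Fin n) (x y : EuclideanSpace ℝ (Fin d)) {a b : ℝ} (h : a + b = 1) :
    A.form i (a • x + b • y) = a * A.form i x + b * A.form i y := by
  obtain rfl : a = 1 - b := by linarith
  simp only [form, inner_add_right, inner_smul_right]; ring

@[fun_prop]
theorem continuous_form (i : Fin n) : Continuous (A.form i) := by
  unfold form; fun_prop

theorem mem_complement_iff {x : EuclideanSpace ℝ (Fin d)} :
    x ∈ A.complement ↔ ∀ i, A.form i x ≠ 0 := by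
  simp [complement, mem_hyperplane_iff]

end HyperplaneArrangement

/-! ### Topes as cells of realised sign patterns -/

/-- The sign `1` on `S` and `-1` off `S`. -/
def patternSign {n : ℕ} (S : Finset (Fin n)) (i : Fin n) : ℝ := if i ∈ S then 1 else -1

theorem patternSign_mul_self {n : ℕ} (S : Finset (Fin n)) (i : Fin n) :
    patternSign S i * patternSign S i = 1 := by
  unfold patternSign; split_ifs <;> norm_num

theorem patternSign_ne_zero {n : ℕ} (S : Finset (Fin n)) (i : Fin n) : patternSign S i ≠ 0 :=
  left_ne_zero_of_mul_eq_one (patternSign_mul_self S i)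

theorem patternSign_congr {n : ℕ} {S S' : Finset (Fin n)} {i : Fin n} (h : i ∈ S ↔ i ∈ S') :
    patternSign S i = patternSign S' i := by
  simp [patternSign, h]

theorem patternSign_eq_neg {n : ℕ} {S S' : Finset (Fin n)} {i : Fin n} (h : ¬ (i ∈ S ↔ i ∈ S')) :
    patternSign S i = -patternSign S' i := by
  unfold patternSign; split_ifs <;> simp_all

namespace HyperplaneArrangement

variable {d n : ℕ} (A : HyperplaneArrangement d n)

/-- The open cell where the forms are positive on `S` and negative off `S`. -/
def cell (S : Finset (Fin n)) : Set (EuclideanSpace ℝ (Fin d)) :=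
  {x | ∀ i, 0 < patternSign S i * A.form i x}

/-- The closed polyhedron where the forms are nonnegative on `S` and nonpositive off `S`. -/
def closedCell (S : Finset (Fin n)) : Set (EuclideanSpace ℝ (Fin d)) :=
  {x | ∀ i, 0 ≤ patternSign S i * A.form i x}

open Classical in
/-- The sign patterns whose cell is nonempty. -/
noncomputable def patterns : Finset (Finset (Fin n)) :=
  Finset.univ.filter fun S => (A.cell S).Nonempty

open Classical in
/-- The set of indices of the forms that are positive at `x`. -/
noncomputable def patternAt (x : EuclideanSpace ℝ (Fin d)) : Finset (Fin n) :=
  Finset.univ.filter fun i => 0 < A.form i x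

variable {A}

@[simp]
theorem mem_patterns {S : Finset (Fin n)} : S ∈ A.patterns ↔ (A.cell S).Nonempty := by
  simp [patterns]

theorem mem_cell_iff {S : Finset (Fin n)} {x : EuclideanSpace ℝ (Fin d)} :
    x ∈ A.cell S ↔ ∀ i, if i ∈ S then 0 < A.form i x else A.form i x < 0 := by
  refine forall_congr' fun i => ?_
  unfold patternSign; split_ifs <;> simp

theorem mem_cell_iff_patternAt {S : Finset (Fin n)} {x : EuclideanSpace ℝ (Fin d)} :
    x ∈ A.cell S ↔ x ∈ A.complement ∧ A.patternAt x = S := by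
  rw [mem_cell_iff, mem_complement_iff]
  constructor
  · refine fun h => ⟨fun i => ?_, ?_⟩
    · have := h i
      split_ifs at this <;> first | exact this.ne' | exact this.ne
    · ext i
      have := h i
      simp only [patternAt, Finset.mem_filter, Finset.mem_univ, true_and]
      split_ifs at this with hi
      · simp [hi, this]
      · simp [hi, this.le]
  · rintro ⟨h, rfl⟩ i
    simp only [patternAt, Finset.mem_filter, Finset.mem_univ, true_and]
    split_ifs with hi
    · exact hi
    · exact lt_of_le_of_ne (not_lt.1 hi) (h i)

theorem cell_subset_complement (S : Finset (Fin n)) : A.cell S ⊆ A.complement :=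
  fun _ hx => (mem_cell_iff_patternAt.1 hx).1

theorem convex_cell (S : Finset (Fin n)) : Convex ℝ (A.cell S) := by
  intro x hx y hy a b ha hb hab i
  rw [form_combo i x y hab]
  have h1 := hx i
  have h2 := hy i
  rcases ha.eq_or_lt with rfl | ha
  · obtain rfl : b = 1 := by linarith
    simpa using h2
  · have := mul_pos ha h1
    have := mul_nonneg hb h2.le
    linarith

/-- The cell is convex, hence connected. Conversely, no form can change sign on a connected subset
of the complement, by the intermediate value theorem. -/
theorem connectedComponentIn_eq_cell {S : Finset (Fin n)} {x : EuclideanSpace ℝ (Fin d)}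
    (hx : x ∈ A.cell S) : connectedComponentIn A.complement x = A.cell S := by
  have hxc := cell_subset_complement S hx
  refine Set.Subset.antisymm (fun y hy i => ?_)
    ((convex_cell S).isPreconnected.subset_connectedComponentIn hx (cell_subset_complement S))
  by_contra hneg
  have hsub := connectedComponentIn_subset A.complement x
  have hcont : ContinuousOn (fun z => patternSign S i * A.form i z)
      (connectedComponentIn A.complement x) := by fun_prop
  obtain ⟨z, hz, hz0⟩ := isPreconnected_connectedComponentIn.intermediate_value hy
    (mem_connectedComponentIn hxc) hcont ⟨not_lt.1 hneg, (hx i).le⟩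
  exact mem_complement_iff.1 (hsub hz) i
    ((mul_eq_zero.1 hz0).resolve_left (patternSign_ne_zero S i))

theorem cell_mem_topes {S : Finset (Fin n)} (hS : S ∈ A.patterns) : A.cell S ∈ A.topes := by
  obtain ⟨x, hx⟩ := mem_patterns.1 hS
  exact ⟨x, cell_subset_complement S hx, (connectedComponentIn_eq_cell hx).symm⟩

theorem exists_cell_eq {T : Set (EuclideanSpace ℝ (Fin d))} (hT : T ∈ A.topes) :
    ∃ S ∈ A.patterns, A.cell S = T := by
  obtain ⟨x, hx, rfl⟩ := hT
  have hxS : x ∈ A.cell (A.patternAt x) := mem_cell_iff_patternAt.2 ⟨hx, rfl⟩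
  exact ⟨_, mem_patterns.2 ⟨x, hxS⟩, (connectedComponentIn_eq_cell hxS).symm⟩

theorem cell_injOn : Set.InjOn A.cell A.patterns := by
  intro S hS S' _ h
  obtain ⟨x, hx⟩ := mem_patterns.1 hS
  rw [← (mem_cell_iff_patternAt.1 hx).2]
  rw [h] at hx
  exact (mem_cell_iff_patternAt.1 hx).2

variable (A) in
/-- The correspondence between realised sign patterns and topes. -/
noncomputable def patternsEquiv : A.patterns ≃ A.topes :=
  Equiv.ofBijective (fun S => ⟨A.cell S, cell_mem_topes S.2⟩)
    ⟨fun S S' h => Subtype.ext (cell_injOn S.2 S'.2 (congrArg Subtype.val h)), fun T => by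
      obtain ⟨S, hS, h⟩ := exists_cell_eq T.2
      exact ⟨⟨S, hS⟩, Subtype.ext h⟩⟩

@[simp]
theorem coe_patternsEquiv (S : A.patterns) : (A.patternsEquiv S : Set _) = A.cell S := rfl

theorem finite_topes : A.topes.Finite :=
  Set.finite_coe_iff.1 (Finite.of_equiv _ A.patternsEquiv)

theorem closure_cell {S : Finset (Fin n)} (hS : S ∈ A.patterns) :
    closure (A.cell S) = A.closedCell S := by
  refine Set.Subset.antisymm (closure_minimal (fun x hx i => (hx i).le) ?_) fun x hx => ?_
  · simp only [closedCell, Set.ofPred_forall]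
    exact isClosed_iInter fun i => isClosed_le continuous_const (by fun_prop)
  · obtain ⟨p, hp⟩ := mem_patterns.1 hS
    -- Every point of the closed cell is approached from the open cell along the segment to `p`.
    have hlim : Filter.Tendsto (fun t : ℝ => (1 - t) • x + t • p) (nhdsWithin 0 (Set.Ioi 0))
        (nhds x) := by
      have : Continuous fun t : ℝ => (1 - t) • x + t • p := by fun_prop
      simpa using (this.tendsto 0).mono_left nhdsWithin_le_nhds
    refine mem_closure_of_tendsto hlim ?_
    filter_upwards [Ioo_mem_nhdsGT (zero_lt_one' ℝ)] with t ht i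
    rw [form_combo i x p (by ring)]
    have h1 := mul_pos ht.1 (hp i)
    have h2 := mul_nonneg (sub_nonneg.2 ht.2.le) (hx i)
    linarith

end HyperplaneArrangement

/-! ### Patterns differing at one index give adjacent topes -/

namespace HyperplaneArrangement

variable {d n : ℕ} {A : HyperplaneArrangement d n}

/-- `S` and `S'` differ exactly at the index `i`. -/
def DifferAt (S S' : Finset (Fin n)) (i : Fin n) : Prop := ∀ j, (j ∈ S ↔ j ∈ S') ↔ j ≠ i

theorem DifferAt.symm {S S' : Finset (Fin n)} {i : Fin n} (h : DifferAt S S' i) :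
    DifferAt S' S i := fun j => by rw [← h j]; exact iff_comm

theorem DifferAt.sign_eq_neg {S S' : Finset (Fin n)} {i : Fin n} (h : DifferAt S S' i) :
    patternSign S i = -patternSign S' i :=
  patternSign_eq_neg fun h' => (h i).1 h' rfl

theorem DifferAt.sign_eq {S S' : Finset (Fin n)} {i j : Fin n} (h : DifferAt S S' i)
    (hj : j ≠ i) : patternSign S j = patternSign S' j :=
  patternSign_congr ((h j).2 hj)

theorem closedCell_inter_closedCell {S S' : Finset (Fin n)} {i : Fin n} (h : DifferAt S S' i) :
    A.closedCell S ∩ A.closedCell S' = {x ∈ A.closedCell S | A.form i x = 0} := by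
  ext x
  refine and_congr_right fun hx => ⟨fun hx' => ?_, fun h0 j => ?_⟩
  · have h1 := hx i
    have h2 := hx' i
    rw [h.sign_eq_neg] at h1
    exact (mul_eq_zero.1 (by linarith : patternSign S' i * A.form i x = 0)).resolve_left
      (patternSign_ne_zero S' i)
  · by_cases hj : j = i
    · subst hj; rw [h0, mul_zero]
    · rw [← h.sign_eq hj]; exact hx j

/-- A segment joining the two cells crosses only hyperplane `i`; the weights are those at which form
`i` vanishes. The crossing point is a relative interior point of the common wall. -/
theorem exists_mem_wall {S S' : Finset (Fin n)} {i : Fin n} (h : DifferAt S S' i)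
    (hS : S ∈ A.patterns) (hS' : S' ∈ A.patterns) :
    ∃ r, A.form i r = 0 ∧ ∀ j ≠ i, 0 < patternSign S j * A.form j r := by
  obtain ⟨p, hp⟩ := mem_patterns.1 hS
  obtain ⟨q, hq⟩ := mem_patterns.1 hS'
  have hpi := hp i
  have hqi := hq i
  set u := patternSign S i * A.form i p with hu
  set v := patternSign S' i * A.form i q with hv
  have huv : 0 < u + v := by positivity
  have h1 : v / (u + v) + u / (u + v) = 1 := by field_simp; ring
  refine ⟨(v / (u + v)) • p + (u / (u + v)) • q, ?_, fun j hj => ?_⟩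
  · rw [form_combo i p q h1]
    have : v / (u + v) * A.form i p + u / (u + v) * A.form i q =
      (v * A.form i p + u * A.form i q) / (u + v) := by ring
    rw [this, hu, hv, h.sign_eq_neg]
    ring
  · rw [form_combo j p q h1, mul_add, mul_left_comm, mul_left_comm (patternSign S j)]
    have hp' := hp j
    have hq' := hq j
    rw [← h.sign_eq hj] at hq'
    positivity

theorem isFacet_closedCell_inter {S S' : Finset (Fin n)} {i : Fin n} (h : DifferAt S S' i)
    (hS : S ∈ A.patterns) (hS' : S' ∈ A.patterns) :
    IsFacet (A.closedCell S) (A.closedCell S ∩ A.closedCell S') := by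
  obtain ⟨r, hr0, hr⟩ := exists_mem_wall h hS hS'
  rw [closedCell_inter_closedCell h]
  have hrF : r ∈ {x ∈ A.closedCell S | A.form i x = 0} := by
    refine ⟨fun j => ?_, hr0⟩
    by_cases hj : j = i
    · subst hj; rw [hr0, mul_zero]
    · exact (hr j hj).le
  refine ⟨⟨r, hrF⟩, fun _ => ⟨-(patternSign S i • innerSL ℝ (A.normal i)), ?_⟩, ?_⟩
  · have key : ∀ x y, (-(patternSign S i • innerSL ℝ (A.normal i))) y ≤
        (-(patternSign S i • innerSL ℝ (A.normal i))) x ↔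
        patternSign S i * A.form i x ≤ patternSign S i * A.form i y := by
      intro x y
      simp only [form, mul_sub, neg_apply, smul_apply, innerSL_apply_apply, smul_eq_mul]
      constructor <;> intro h <;> linarith
    ext x
    refine and_congr_right fun hx => ⟨fun h0 y hy => ?_, fun hmax => ?_⟩
    · rw [key, h0, mul_zero]; exact hy i
    · have h1 := (key _ _).1 (hmax r hrF.1)
      rw [hr0, mul_zero] at h1
      exact (mul_eq_zero.1 (le_antisymm h1 (hx i))).resolve_left (patternSign_ne_zero S i)
  · have hspan : affineSpan ℝ {x ∈ A.closedCell S | A.form i x = 0} = A.hyperplane i := by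
      refine le_antisymm (affineSpan_le.2 fun x hx => mem_hyperplane_iff.2 hx.2) fun x hx => ?_
      have hx0 := mem_hyperplane_iff.1 hx
      -- A short move from `r` towards `x` inside hyperplane `i` stays in the face, so `x` is
      -- recovered by extrapolating with factor `t⁻¹`. Thus the face spans the hyperplane.
      have hev : ∀ᶠ t : ℝ in nhdsWithin 0 (Set.Ioi 0), ∀ j, j ≠ i →
          0 < patternSign S j * A.form j (AffineMap.lineMap r x t) := by
        refine Filter.eventually_all.2 fun j => ?_
        by_cases hj : j = i
        · simp [hj]
        have hc : Continuous fun t : ℝ => patternSign S j * A.form j (AffineMap.lineMap r x t) := by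
          have := AffineMap.lineMap_continuous (R := ℝ) (p := r) (q := x)
          fun_prop
        have h0 : 0 < patternSign S j * A.form j (AffineMap.lineMap r x (0 : ℝ)) := by
          simpa using hr j hj
        filter_upwards [nhdsWithin_le_nhds ((hc.tendsto 0).eventually (lt_mem_nhds h0))]
          with t ht _ using ht
      obtain ⟨t, ht, htpos⟩ := (hev.and self_mem_nhdsWithin).exists
      have hti : A.form i (AffineMap.lineMap r x t) = 0 := by
        rw [AffineMap.lineMap_apply_module, form_combo i r x (by ring), hr0, hx0]; simp
      have hmem : AffineMap.lineMap r x t ∈ {x ∈ A.closedCell S | A.form i x = 0} := by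
        refine ⟨fun j => ?_, hti⟩
        by_cases hj : j = i
        · subst hj; rw [hti, mul_zero]
        · exact (ht j hj).le
      have := AffineMap.lineMap_mem t⁻¹ (subset_affineSpan ℝ _ hrF) (subset_affineSpan ℝ _ hmem)
      rwa [AffineMap.lineMap_lineMap_right, inv_mul_cancel₀ (ne_of_gt htpos),
        AffineMap.lineMap_apply_one] at this
    rw [hspan]
    exact A.finrank_direction i

theorem topeGraph_adj_of_differAt {S S' : A.patterns} {i : Fin n}
    (h : DifferAt S.1 S'.1 i) :
    A.topeGraph.Adj (A.patternsEquiv S) (A.patternsEquiv S') := by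
  refine ⟨fun heq => ?_, ?_, ?_⟩
  · have := A.patternsEquiv.injective heq
    subst this
    exact (h i).1 Iff.rfl rfl
  · rw [coe_patternsEquiv, coe_patternsEquiv, closure_cell S.2, closure_cell S'.2]
    exact isFacet_closedCell_inter h S.2 S'.2
  · rw [coe_patternsEquiv, coe_patternsEquiv, closure_cell S.2, closure_cell S'.2, Set.inter_comm]
    exact isFacet_closedCell_inter h.symm S'.2 S.2

/-! ### Upper bound on the number of topes -/

theorem sum_mul_form_eq {s : Finset (Fin n)} {c : s → ℝ} (hc : ∑ i, c i • A.normal i = 0)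
    (x : EuclideanSpace ℝ (Fin d)) : ∑ i, c i * A.form i x = ∑ i, c i * A.form i 0 := by
  have h : inner ℝ (∑ i, c i • A.normal i) x = (0 : ℝ) := by rw [hc, inner_zero_left]
  rw [sum_inner] at h
  simp only [real_inner_smul_left] at h
  simp only [form, mul_sub, Finset.sum_sub_distrib, h, inner_zero_right, mul_zero,
    Finset.sum_const_zero]

/-- More than `d` normals are linearly dependent, so some nontrivial combination of the forms is
constant. A cell whose signs match the coefficients would make it positive, while the coefficients
can be negated to make the constant nonpositive. -/
theorem card_le_of_shatters {s : Finset (Fin n)} (hs : A.patterns.Shatters s) : s.card ≤ d := by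
  by_contra! hcard
  have hdep : ¬ LinearIndependent ℝ (fun i : s => A.normal i) := fun h => by
    have := h.fintype_card_le_finrank
    rw [finrank_euclideanSpace_fin, Fintype.card_coe] at this
    omega
  obtain ⟨c, hsum, hle, i₀, hi₀⟩ : ∃ c : s → ℝ, ∑ i, c i • A.normal i = 0 ∧
      ∑ i, c i * A.form i 0 ≤ 0 ∧ ∃ i, c i ≠ 0 := by
    obtain ⟨c, hsum, i₀, hi₀⟩ := Fintype.not_linearIndependent_iff.1 hdep
    rcases le_total (∑ i, c i * A.form i 0) 0 with h | h
    · exact ⟨c, hsum, h, i₀, hi₀⟩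
    · refine ⟨-c, ?_, ?_, i₀, neg_ne_zero.2 hi₀⟩
      · simpa using hsum
      · simpa using h
  obtain ⟨u, hu, hsu⟩ := hs (t := (Finset.univ.filter fun i => 0 < c i).map
    (Function.Embedding.subtype _)) fun i hi => by
      obtain ⟨j, -, rfl⟩ := Finset.mem_map.1 hi
      exact j.2
  have hmem : ∀ i : s, (i : Fin n) ∈ u ↔ 0 < c i := fun i => by
    have : (i : Fin n) ∈ s ∩ u ↔ 0 < c i := by rw [hsu]; simp
    rw [← this, Finset.mem_inter, and_iff_right i.2]
  obtain ⟨x, hx⟩ := mem_patterns.1 hu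
  rw [mem_cell_iff] at hx
  have hpos : ∀ i : s, c i ≠ 0 → 0 < c i * A.form i x := fun i hi => by
    have h := hx i
    by_cases hci : 0 < c i
    · rw [if_pos ((hmem i).2 hci)] at h
      exact mul_pos hci h
    · rw [if_neg (mt (hmem i).1 hci)] at h
      exact mul_pos_of_neg_of_neg (lt_of_le_of_ne (not_lt.1 hci) hi) h
  have : 0 < ∑ i, c i * A.form i x := by
    refine Finset.sum_pos' (fun i _ => ?_) ⟨i₀, Finset.mem_univ _, hpos i₀ hi₀⟩
    by_cases hci : c i = 0
    · rw [hci, zero_mul]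
    · exact (hpos i hci).le
  rw [sum_mul_form_eq hsum x] at this
  linarith

theorem card_patterns_le : A.patterns.card ≤ ∑ k ∈ Finset.Iic d, n.choose k := by
  have hvc : A.patterns.vcDim ≤ d :=
    Finset.sup_le fun s hs => card_le_of_shatters (Finset.mem_shatterer.1 hs)
  refine A.patterns.card_le_card_shatterer.trans
    ((Finset.card_shatterer_le_sum_vcDim).trans ?_)
  rw [Fintype.card_fin]
  exact Finset.sum_le_sum_of_subset (Finset.Iic_subset_Iic.2 hvc)

end HyperplaneArrangement

/-! ### Vertices, and the lower bound on each colour class -/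

namespace HyperplaneArrangement

variable {d n : ℕ} {A : HyperplaneArrangement d n}

/-- `v` is the vertex where exactly the hyperplanes indexed by `I` meet, and `e` is the basis dual
to their normals. -/
structure IsVertex (A : HyperplaneArrangement d n) (I : Finset (Fin n))
    (v : EuclideanSpace ℝ (Fin d)) (e : Fin n → EuclideanSpace ℝ (Fin d)) : Prop where
  form_eq_zero : ∀ i ∈ I, A.form i v = 0
  form_ne_zero : ∀ j ∉ I, A.form j v ≠ 0
  inner_dual : ∀ i ∈ I, ∀ j ∈ I, inner ℝ (A.normal i) (e j) = if i = j then (1 : ℝ) else 0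
  eq_zero : ∀ x, (∀ i ∈ I, inner ℝ (A.normal i) x = (0 : ℝ)) → x = 0

theorem IsSimple.exists_isVertex (hA : A.IsSimple) {I : Finset (Fin n)} (hI : I.card = d) :
    ∃ v e, A.IsVertex I v e := by
  obtain ⟨⟨v, hv⟩, hfin⟩ := hA.1 I hI.le
  have hfin0 : Module.finrank ℝ (⨅ i ∈ I, A.hyperplane i).direction = 0 := by omega
  rw [Submodule.finrank_eq_zero] at hfin0
  simp only [Set.mem_iInter, SetLike.mem_coe, mem_hyperplane_iff] at hv
  have hzero : ∀ x, (∀ i ∈ I, inner ℝ (A.normal i) x = (0 : ℝ)) → x = 0 := by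
    intro x hx
    have h1 : v ∈ ⨅ i ∈ I, A.hyperplane i := by
      simpa [AffineSubspace.mem_iInf_iff, mem_hyperplane_iff] using hv
    have h2 : v + x ∈ ⨅ i ∈ I, A.hyperplane i := by
      simp only [AffineSubspace.mem_iInf_iff, mem_hyperplane_iff]
      intro i hi
      rw [form_add, hv i hi, hx i hi, add_zero]
    have := AffineSubspace.vsub_mem_direction h2 h1
    rw [hfin0] at this
    simpa using this
  let L : EuclideanSpace ℝ (Fin d) →ₗ[ℝ] (I → ℝ) :=
    LinearMap.pi fun i => (innerSL ℝ (A.normal i) : EuclideanSpace ℝ (Fin d) →ₗ[ℝ] ℝ)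
  -- Simplicity makes `L` injective, hence bijective as `I.card = d`; the dual basis consists of the
  -- preimages of the standard basis.
  have hL : ∀ x i, L x i = inner ℝ (A.normal i) x := fun x i => rfl
  have hinj : Function.Injective L := by
    rw [← LinearMap.ker_eq_bot, LinearMap.ker_eq_bot']
    exact fun x hx => hzero x fun i hi => by rw [← hL x ⟨i, hi⟩, hx]; rfl
  have hsurj : Function.Surjective L :=
    (LinearMap.injective_iff_surjective_of_finrank_eq_finrank (by simp [hI])).1 hinj
  refine ⟨v, fun j => if hj : j ∈ I then (hsurj (Pi.single ⟨j, hj⟩ 1)).choose else 0, hv,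
    fun j hj h0 => ?_, fun i hi j hj => ?_, hzero⟩
  · have h := hA.2 (insert j I) (by rw [Finset.card_insert_of_notMem hj]; omega)
    refine Set.notMem_empty v (h ▸ ?_)
    simp only [Set.mem_iInter, SetLike.mem_coe, mem_hyperplane_iff, Finset.mem_insert]
    rintro i (rfl | hi)
    exacts [h0, hv i hi]
  · rw [dif_pos hj, ← hL _ ⟨i, hi⟩, (hsurj (Pi.single ⟨j, hj⟩ 1)).choose_spec, Pi.single_apply]
    simp

namespace IsVertex

variable {I : Finset (Fin n)} {v : EuclideanSpace ℝ (Fin d)}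
  {e : Fin n → EuclideanSpace ℝ (Fin d)}

theorem dual_ne_zero (h : A.IsVertex I v e) {i : Fin n} (hi : i ∈ I) : e i ≠ 0 := fun h0 => by
  have := h.inner_dual i hi i hi
  simp [h0] at this

theorem sum_dual (h : A.IsVertex I v e) (c : Fin n → ℝ) {i : Fin n} (hi : i ∈ I) :
    inner ℝ (A.normal i) (∑ j ∈ I, c j • e j) = c i := by
  simp only [inner_sum, inner_smul_right]
  rw [Finset.sum_eq_single_of_mem i hi, h.inner_dual i hi i hi, if_pos rfl, mul_one]
  intro j hj hji
  rw [h.inner_dual i hi j hj, if_neg hji.symm, mul_zero]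

theorem eq_add_sum (h : A.IsVertex I v e) (x : EuclideanSpace ℝ (Fin d)) :
    x = v + ∑ i ∈ I, A.form i x • e i := by
  refine sub_eq_zero.1 (h.eq_zero _ fun i hi => ?_)
  have h1 := form_add (A := A) i v (x - v)
  rw [add_sub_cancel, h.form_eq_zero i hi, zero_add] at h1
  rw [← sub_sub, inner_sub_right, ← h1, h.sum_dual _ hi, sub_self]

/-- The cell of `S` is one of those having `v` in its closure. -/
theorem mem_patterns (h : A.IsVertex I v e) {S : Finset (Fin n)}
    (hS : ∀ j ∉ I, j ∈ S ↔ 0 < A.form j v) : S ∈ A.patterns := by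
  -- The displacement gives the forms in `I` the signs prescribed by `S`; the others are nonzero at
  -- `v` and keep their signs for small `t`.
  have hev : ∀ᶠ t : ℝ in nhdsWithin 0 (Set.Ioi 0), ∀ j,
      0 < patternSign S j * A.form j (v + t • ∑ i ∈ I, patternSign S i • e i) := by
    refine Filter.eventually_all.2 fun j => ?_
    by_cases hj : j ∈ I
    · filter_upwards [self_mem_nhdsWithin] with t ht
      rw [form_add, h.form_eq_zero j hj, inner_smul_right, h.sum_dual _ hj, zero_add,
        mul_left_comm, patternSign_mul_self, mul_one]
      exact ht
    · have hc : Continuous fun t : ℝ =>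
          patternSign S j * A.form j (v + t • ∑ i ∈ I, patternSign S i • e i) := by fun_prop
      have h0 : 0 < patternSign S j *
          A.form j (v + (0 : ℝ) • ∑ i ∈ I, patternSign S i • e i) := by
        rw [zero_smul, add_zero]
        have h1 := hS j hj
        have h2 := h.form_ne_zero j hj
        unfold patternSign
        split_ifs with hjS
        · rw [one_mul]; exact h1.1 hjS
        · rw [neg_one_mul, neg_pos]
          exact lt_of_le_of_ne (not_lt.1 (mt h1.2 hjS)) h2
      exact nhdsWithin_le_nhds ((hc.tendsto 0).eventually (lt_mem_nhds h0))
  obtain ⟨t, ht⟩ := hev.exists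
  exact HyperplaneArrangement.mem_patterns.2 ⟨_, ht⟩

theorem mem_closedCell (h : A.IsVertex I v e) {S : Finset (Fin n)}
    (hS : ∀ j ∉ I, j ∈ S ↔ 0 < A.form j v) : v ∈ A.closedCell S := by
  intro j
  by_cases hj : j ∈ I
  · rw [h.form_eq_zero j hj, mul_zero]
  · have h1 := hS j hj
    unfold patternSign
    split_ifs with hjS
    · rw [one_mul]; exact (h1.1 hjS).le
    · rw [neg_one_mul, neg_nonneg]
      exact not_lt.1 (mt h1.2 hjS)

theorem mul_form_nonneg {w : Module.Dual ℝ (EuclideanSpace ℝ (Fin d))} {S : Finset (Fin n)}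
    (hw : ∀ i ∈ I, 0 < patternSign S i * w (e i)) {x : EuclideanSpace ℝ (Fin d)}
    (hx : x ∈ A.closedCell S) : ∀ i ∈ I, 0 ≤ A.form i x * w (e i) := by
  intro i hi
  have h1 := mul_nonneg (hx i) (hw i hi).le
  have h2 : patternSign S i * A.form i x * (patternSign S i * w (e i)) =
      (patternSign S i * patternSign S i) * (A.form i x * w (e i)) := by ring
  rwa [h2, patternSign_mul_self, one_mul] at h1

theorem apply_eq (h : A.IsVertex I v e) (w : Module.Dual ℝ (EuclideanSpace ℝ (Fin d)))
    (x : EuclideanSpace ℝ (Fin d)) : w x = w v + ∑ i ∈ I, A.form i x * w (e i) := by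
  conv_lhs => rw [h.eq_add_sum x]
  simp

theorem apply_le (h : A.IsVertex I v e) {w : Module.Dual ℝ (EuclideanSpace ℝ (Fin d))}
    {S : Finset (Fin n)} (hw : ∀ i ∈ I, 0 < patternSign S i * w (e i))
    {x : EuclideanSpace ℝ (Fin d)} (hx : x ∈ A.closedCell S) : w v ≤ w x := by
  rw [h.apply_eq w x]
  exact le_add_of_nonneg_right (Finset.sum_nonneg (mul_form_nonneg hw hx))

/-- In the expansion of `w x - w v` along the dual basis every term is nonnegative on the closed
cell, so equality forces each to vanish. -/
theorem form_eq_zero_of_apply_le (h : A.IsVertex I v e)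
    {w : Module.Dual ℝ (EuclideanSpace ℝ (Fin d))}
    {S : Finset (Fin n)} (hw : ∀ i ∈ I, 0 < patternSign S i * w (e i))
    {x : EuclideanSpace ℝ (Fin d)} (hx : x ∈ A.closedCell S) (hle : w x ≤ w v) :
    ∀ i ∈ I, A.form i x = 0 := by
  rw [h.apply_eq w x] at hle
  have h0 : ∑ i ∈ I, A.form i x * w (e i) = 0 :=
    le_antisymm (by linarith) (Finset.sum_nonneg (mul_form_nonneg hw hx))
  intro i hi
  have h1 := (Finset.sum_eq_zero_iff_of_nonneg (mul_form_nonneg hw hx)).1 h0 i hi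
  exact (mul_eq_zero.1 h1).resolve_right (right_ne_zero_of_mul (hw i hi).ne')

/-- A linear functional attains its minimum over a closed cell at no more than one vertex
in general position. -/
theorem subset_of_isMin {I' : Finset (Fin n)} {v' : EuclideanSpace ℝ (Fin d)}
    {e' : Fin n → EuclideanSpace ℝ (Fin d)} (h : A.IsVertex I v e) (h' : A.IsVertex I' v' e')
    {w : Module.Dual ℝ (EuclideanSpace ℝ (Fin d))} {S : Finset (Fin n)}
    (hS : ∀ j ∉ I, j ∈ S ↔ 0 < A.form j v) (hS' : ∀ j ∉ I', j ∈ S ↔ 0 < A.form j v')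
    (hw : ∀ i ∈ I, 0 < patternSign S i * w (e i))
    (hw' : ∀ i ∈ I', 0 < patternSign S i * w (e' i)) : I ⊆ I' := by
  intro i hi
  by_contra hi'
  exact h'.form_ne_zero i hi' (h.form_eq_zero_of_apply_le hw (h'.mem_closedCell hS')
    (h'.apply_le hw' (h.mem_closedCell hS)) i hi)

-- All cells obtained by flipping signs in `I` are realised around `v`, and each single flip crosses
-- a wall and changes the colour.
open scoped symmDiff in
theorem colour_symmDiff (h : A.IsVertex I v e) {χ : Finset (Fin n) → Bool}
    (hχ : ∀ S ∈ A.patterns, ∀ S' ∈ A.patterns, ∀ i, DifferAt S S' i → χ S ≠ χ S')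
    {S : Finset (Fin n)} (hS : ∀ j ∉ I, j ∈ S ↔ 0 < A.form j v) (Q : Finset (Fin n))
    (hQ : Q ⊆ I) : χ (S ∆ Q) = (χ S ^^ decide (Odd Q.card)) := by
  have hagree : ∀ R ⊆ I, S ∆ R ∈ A.patterns := fun R hR => h.mem_patterns fun j hj => by
    rw [← hS j hj, Finset.mem_symmDiff]
    have := mt (@hR j) hj
    tauto
  induction Q using Finset.induction_on with
  | empty => rw [← Finset.bot_eq_empty, symmDiff_bot]; simp
  | insert i Q hi ih =>
    have hQI := (Finset.subset_insert i Q).trans hQ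
    have hdiff : DifferAt (S ∆ insert i Q) (S ∆ Q) i := by
      intro j
      simp only [Finset.mem_symmDiff, Finset.mem_insert]
      by_cases hj : j = i
      · subst hj; simp only [hi]; tauto
      · simp [hj]
    have := hχ _ (hagree _ hQ) _ (hagree _ hQI) i hdiff
    rw [ih hQI] at this
    rw [Finset.card_insert_of_notMem hi, Bool.eq_not_of_ne this]
    by_cases hodd : Odd Q.card <;> simp [Nat.odd_add_one, hodd]

end IsVertex

open scoped symmDiff in
theorem patternSign_symmDiff {I S : Finset (Fin n)} {i : Fin n} (hi : i ∈ I) :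
    patternSign (S ∆ I) i = -patternSign S i :=
  patternSign_eq_neg (by rw [Finset.mem_symmDiff]; tauto)

open scoped symmDiff in
/-- In odd dimension, opposite cells at a vertex have different colours, so that each colour is used
on at least half as many cells as there are vertices. -/
theorem IsSimple.choose_le_two_mul_card (hA : A.IsSimple) (hd : Odd d)
    {χ : Finset (Fin n) → Bool}
    (hχ : ∀ S ∈ A.patterns, ∀ S' ∈ A.patterns, ∀ i, DifferAt S S' i → χ S ≠ χ S') (k : Bool) :
    n.choose d ≤ 2 * (A.patterns.filter fun S => χ S = k).card := by
  classical
  have hex : ∀ I : Finset (Fin n), ∃ v e, I.card = d → A.IsVertex I v e := fun I => by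
    by_cases hI : I.card = d
    · obtain ⟨v, e, h⟩ := hA.exists_isVertex hI
      exact ⟨v, e, fun _ => h⟩
    · exact ⟨0, 0, fun h => absurd h hI⟩
  choose v e hv using hex
  -- Genericity: `w` vanishes on no dual basis vector of any vertex.
  obtain ⟨w, hw⟩ := Module.exists_dual_forall_apply_ne_zero (K := ℝ)
    (fun p : {p : Finset (Fin n) × Fin n // p.1.card = d ∧ p.2 ∈ p.1} => e p.1.1 p.1.2)
    fun p => (hv _ p.2.1).dual_ne_zero p.2.2
  -- `φ I` is the cell at `v I` on which `w` is minimised there; the opposite cell `φ I ∆ I` plays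
  -- the same role for `-w`.
  let φ : Finset (Fin n) → Finset (Fin n) := fun I =>
    Finset.univ.filter fun j => if j ∈ I then 0 < w (e I j) else 0 < A.form j (v I)
  have hφ : ∀ I, ∀ j ∉ I, j ∈ φ I ↔ 0 < A.form j (v I) := fun I j hj => by simp [φ, hj]
  have hψ : ∀ I, ∀ j ∉ I, j ∈ φ I ∆ I ↔ 0 < A.form j (v I) := fun I j hj => by
    rw [← hφ I j hj, Finset.mem_symmDiff]; tauto
  have hwφ : ∀ I : Finset (Fin n), I.card = d → ∀ i ∈ I, 0 < patternSign (φ I) i * w (e I i) := by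
    intro I hI i hi
    have hne : w (e I i) ≠ 0 := hw ⟨(I, i), hI, hi⟩
    have hmem : i ∈ φ I ↔ 0 < w (e I i) := by simp [φ, hi]
    unfold patternSign
    split_ifs with h
    · rw [one_mul]; exact hmem.1 h
    · rw [neg_one_mul, neg_pos]
      exact lt_of_le_of_ne (not_lt.1 (mt hmem.2 h)) hne
  have hwψ : ∀ I : Finset (Fin n), I.card = d →
      ∀ i ∈ I, 0 < patternSign (φ I ∆ I) i * (-w) (e I i) := by
    intro I hI i hi
    rw [patternSign_symmDiff hi, LinearMap.neg_apply, neg_mul_neg]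
    exact hwφ I hI i hi
  have hφinj : Set.InjOn φ {I | I.card = d} := fun I hI J hJ h =>
    Finset.Subset.antisymm
      ((hv I hI).subset_of_isMin (hv J hJ) (hφ I) (h ▸ hφ J) (hwφ I hI) (h ▸ hwφ J hJ))
      ((hv J hJ).subset_of_isMin (hv I hI) (hφ J) (h ▸ hφ I) (hwφ J hJ) (h ▸ hwφ I hI))
  have hψinj : Set.InjOn (fun I => φ I ∆ I) {I | I.card = d} := fun I hI J hJ h => by
    change φ I ∆ I = φ J ∆ J at h
    exact Finset.Subset.antisymm
      ((hv I hI).subset_of_isMin (hv J hJ) (hψ I) (h ▸ hψ J) (hwψ I hI) (h ▸ hwψ J hJ))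
      ((hv J hJ).subset_of_isMin (hv I hI) (hψ J) (h ▸ hψ I) (hwψ J hJ) (h ▸ hwψ I hI))
  have hcol : ∀ I : Finset (Fin n), I.card = d → χ (φ I ∆ I) = !χ (φ I) := by
    intro I hI
    rw [(hv I hI).colour_symmDiff hχ (hφ I) I subset_rfl, hI]
    simp [hd]
  set V := Finset.powersetCard d (Finset.univ : Finset (Fin n)) with hV
  have hVd : ∀ I ∈ V, I.card = d := fun I hI => (Finset.mem_powersetCard.1 hI).2
  -- Each `I` contributes a cell of colour `k`: `φ I` if it has that colour, its opposite otherwise.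
  -- Each case is injective, whence the factor `2`.
  have h1 : (V.filter fun I => χ (φ I) = k).card ≤
      (A.patterns.filter fun S => χ S = k).card := by
    refine Finset.card_le_card_of_injOn φ (fun I hI => ?_) (hφinj.mono fun I hI => ?_)
    · obtain ⟨hIV, hk⟩ := Finset.mem_filter.1 hI
      exact Finset.mem_filter.2 ⟨(hv I (hVd I hIV)).mem_patterns (hφ I), hk⟩
    · exact hVd I (Finset.mem_filter.1 hI).1
  have h2 : (V.filter fun I => ¬ χ (φ I) = k).card ≤
      (A.patterns.filter fun S => χ S = k).card := by
    refine Finset.card_le_card_of_injOn (fun I => φ I ∆ I) (fun I hI => ?_)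
      (hψinj.mono fun I hI => ?_)
    · obtain ⟨hIV, hk⟩ := Finset.mem_filter.1 hI
      refine Finset.mem_filter.2 ⟨(hv I (hVd I hIV)).mem_patterns (hψ I), ?_⟩
      rw [hcol I (hVd I hIV)]
      exact (Bool.eq_not_of_ne (Ne.symm hk)).symm
    · exact hVd I (Finset.mem_filter.1 hI).1
  have h3 := Finset.card_filter_add_card_filter_not (s := V) fun I => χ (φ I) = k
  rw [hV, Finset.card_powersetCard, Finset.card_univ, Fintype.card_fin, ← hV] at h3
  omega

end HyperplaneArrangement

/-! ### Colour counts and the asymptotic bound -/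

namespace HyperplaneArrangement

variable {d n : ℕ} {A : HyperplaneArrangement d n}

open Classical in
/-- The colour of the tope with a given sign pattern. -/
noncomputable def patternColour (C : A.topeGraph.Coloring Bool) (S : Finset (Fin n)) : Bool :=
  if hS : S ∈ A.patterns then C (A.patternsEquiv ⟨S, hS⟩) else false

theorem patternColour_coe (C : A.topeGraph.Coloring Bool) (S : A.patterns) :
    patternColour C S = C (A.patternsEquiv S) := dif_pos S.2

theorem patternColour_ne (C : A.topeGraph.Coloring Bool) :
    ∀ S ∈ A.patterns, ∀ S' ∈ A.patterns, ∀ i, DifferAt S S' i →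
      patternColour C S ≠ patternColour C S' := by
  intro S hS S' hS' i h
  rw [patternColour_coe C ⟨S, hS⟩, patternColour_coe C ⟨S', hS'⟩]
  exact C.valid (topeGraph_adj_of_differAt (S := ⟨S, hS⟩) (S' := ⟨S', hS'⟩) h)

theorem numTopes_eq_card (C : A.topeGraph.Coloring Bool) (k : Bool) :
    A.numTopes C k = (A.patterns.filter fun S => patternColour C S = k).card := by
  have h1 : C.colorClass k = A.patternsEquiv '' {S | C (A.patternsEquiv S) = k} := by
    ext T
    constructor
    · intro hT
      exact ⟨A.patternsEquiv.symm T, by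
        rw [Set.mem_ofPred_eq, Equiv.apply_symm_apply]; exact hT, by simp⟩
    · rintro ⟨S, hS, rfl⟩
      exact hS
  have h2 : ((A.patterns.filter fun S => patternColour C S = k : Finset _) : Set _) =
      Subtype.val '' {S : A.patterns | C (A.patternsEquiv S) = k} := by
    ext S
    simp only [Finset.coe_filter, Set.mem_ofPred_eq, Set.mem_image]
    constructor
    · rintro ⟨hS, hk⟩
      exact ⟨⟨S, hS⟩, by rwa [← patternColour_coe], rfl⟩
    · rintro ⟨S, hS, rfl⟩
      exact ⟨S.2, by rwa [patternColour_coe]⟩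
  rw [numTopes, h1, Set.ncard_image_of_injective _ A.patternsEquiv.injective,
    ← Set.ncard_coe_finset, h2, Set.ncard_image_of_injective _ Subtype.val_injective]

theorem IsSimple.choose_le_two_mul_numTopes (hA : A.IsSimple) (hd : Odd d)
    (C : A.topeGraph.Coloring Bool) (k : Bool) : n.choose d ≤ 2 * A.numTopes C k := by
  rw [numTopes_eq_card]
  exact hA.choose_le_two_mul_card hd (patternColour_ne C) k

theorem numTopes_add_numTopes_le (C : A.topeGraph.Coloring Bool) :
    A.numTopes C true + A.numTopes C false ≤
      ∑ k ∈ Finset.range d, n.choose k + n.choose d := by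
  rw [numTopes_eq_card, numTopes_eq_card, ← Finset.sum_range_succ, Nat.range_succ_eq_Iic]
  refine le_trans (le_of_eq ?_) (card_patterns_le (A := A))
  rw [← Finset.card_filter_add_card_filter_not (s := A.patterns)
    fun S => patternColour C S = true]
  simp

/-- The term `n.choose d` in the bound on `b + c` is at most `2 * c`. -/
theorem IsSimple.numTopes_le (hA : A.IsSimple) (hd : Odd d) (C : A.topeGraph.Coloring Bool) :
    A.numTopes C true ≤ A.numTopes C false + ∑ k ∈ Finset.range d, n.choose k := by
  have h1 := numTopes_add_numTopes_le C
  have h2 := hA.choose_le_two_mul_numTopes hd C false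
  omega

end HyperplaneArrangement

open Filter Asymptotics in
theorem isLittleO_sum_choose (d : ℕ) :
    (fun n : ℕ => ((∑ k ∈ Finset.range d, n.choose k : ℕ) : ℝ)) =o[atTop]
      fun n : ℕ => (n.choose d : ℝ) := by
  simp only [Nat.cast_sum]
  have key : ∀ k ∈ Finset.range d, (fun n : ℕ => (n.choose k : ℝ)) =o[atTop]
      fun n : ℕ => (n.choose d : ℝ) := fun k hk => by
    have h1 : (fun n : ℕ => (n : ℝ) ^ k) =o[atTop] fun n : ℕ => (n : ℝ) ^ d :=
      (isLittleO_pow_pow_atTop_of_lt (Finset.mem_range.1 hk)).comp_tendsto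
        tendsto_natCast_atTop_atTop
    exact ((isTheta_choose k).isBigO.trans_isLittleO h1).trans_isBigO (isTheta_choose d).symm.isBigO
  exact IsLittleO.fun_sum key

theorem exists_forall_numTopes_div_le {d : ℕ} (hd : Odd d) {ε : ℝ} (hε : 0 < ε) :
    ∃ N : ℕ, ∀ n : ℕ, N ≤ n → ∀ A : HyperplaneArrangement d n, A.IsSimple →
      ∀ C : A.topeGraph.Coloring Bool,
        A.topes.Finite ∧ 0 < A.numTopes C false ∧
          (A.numTopes C true : ℝ) / (A.numTopes C false : ℝ) ≤ 1 + ε := by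
  -- With `ε / 2`, the error is at most `ε / 2 * n.choose d ≤ ε * c`; the condition `d ≤ n` makes
  -- `n.choose d`, hence `c`, positive.
  obtain ⟨N, hN⟩ := Filter.eventually_atTop.1
    (((isLittleO_sum_choose d).bound (half_pos hε)).and (Filter.eventually_ge_atTop d))
  refine ⟨N, fun n hn A hA C => ⟨HyperplaneArrangement.finite_topes, ?_⟩⟩
  obtain ⟨h1, hdn⟩ := hN n hn
  rw [Real.norm_natCast, Real.norm_natCast] at h1
  have hM := Nat.choose_pos hdn
  have h2 := hA.choose_le_two_mul_numTopes hd C false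
  have hpos : 0 < A.numTopes C false := by omega
  refine ⟨hpos, ?_⟩
  have h2' : (n.choose d : ℝ) ≤ 2 * A.numTopes C false := mod_cast h2
  have h3 : (A.numTopes C true : ℝ) ≤
      A.numTopes C false + (∑ k ∈ Finset.range d, n.choose k : ℕ) := mod_cast hA.numTopes_le hd C
  rw [div_le_iff₀ (mod_cast hpos)]
  nlinarith

/-! ### Existence of a 2-colouring -/

namespace HyperplaneArrangement

variable {d n : ℕ} {A : HyperplaneArrangement d n}

theorem form_eq_zero_of_mem_closure {S S' : Finset (Fin n)} (hS : S ∈ A.patterns)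
    (hS' : S' ∈ A.patterns) {i : Fin n} (hi : ¬ (i ∈ S ↔ i ∈ S'))
    {x : EuclideanSpace ℝ (Fin d)} (hx : x ∈ closure (A.cell S)) (hx' : x ∈ closure (A.cell S')) :
    A.form i x = 0 := by
  rw [closure_cell hS] at hx
  rw [closure_cell hS'] at hx'
  have h1 := hx i
  have h2 := hx' i
  rw [patternSign_eq_neg hi] at h1
  exact (mul_eq_zero.1 (by linarith : patternSign S' i * A.form i x = 0)).resolve_left
    (patternSign_ne_zero S' i)

/-- If two signs differed, the common face would lie in two hyperplanes, whose intersection has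
dimension `d - 2`, or is empty when `d < 2`. -/
theorem IsSimple.exists_differAt_of_adj (hA : A.IsSimple) {S S' : A.patterns}
    (h : A.topeGraph.Adj (A.patternsEquiv S) (A.patternsEquiv S')) :
    ∃ i, DifferAt S.1 S'.1 i := by
  obtain ⟨hne, ⟨hF, -, hdim⟩, -⟩ := h
  replace hdim : Module.finrank ℝ
      (affineSpan ℝ (closure (A.cell S) ∩ closure (A.cell S'))).direction + 1 = d := hdim
  obtain ⟨x, hx, hx'⟩ := hF
  have hSS : S.1 ≠ S'.1 := fun h => hne (congrArg _ (Subtype.ext h))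
  obtain ⟨i, hi⟩ : ∃ i, ¬ (i ∈ S.1 ↔ i ∈ S'.1) := by
    by_contra! hall
    exact hSS (Finset.ext hall)
  refine ⟨i, fun j => ⟨fun hj hji => hi (hji ▸ hj), fun hji => ?_⟩⟩
  by_contra hj
  have hcard : ({i, j} : Finset (Fin n)).card = 2 := Finset.card_pair (Ne.symm hji)
  have hle : affineSpan ℝ (closure (A.cell S) ∩ closure (A.cell S')) ≤
      ⨅ k ∈ ({i, j} : Finset (Fin n)), A.hyperplane k := by
    refine affineSpan_le.2 fun y hy => ?_
    simp only [SetLike.mem_coe, AffineSubspace.mem_iInf_iff, mem_hyperplane_iff,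
      Finset.mem_insert, Finset.mem_singleton]
    rintro k (rfl | rfl)
    exacts [form_eq_zero_of_mem_closure S.2 S'.2 hi hy.1 hy.2,
      form_eq_zero_of_mem_closure S.2 S'.2 hj hy.1 hy.2]
  rcases le_or_gt 2 d with h2 | h2
  · have h3 := (hA.1 {i, j} (by omega)).2
    have h4 := Submodule.finrank_mono (AffineSubspace.direction_le hle)
    rw [hcard] at h3
    omega
  · have h3 := hA.2 {i, j} (by omega)
    have h4 : x ∈ ⨅ k ∈ ({i, j} : Finset (Fin n)), A.hyperplane k :=
      hle (subset_affineSpan ℝ _ ⟨hx, hx'⟩)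
    refine Set.notMem_empty x (h3 ▸ ?_)
    simpa [AffineSubspace.mem_iInf_iff] using h4

theorem DifferAt.odd_card_iff {S S' : Finset (Fin n)} {i : Fin n} (h : DifferAt S S' i) :
    Odd S.card ↔ ¬ Odd S'.card := by
  wlog hi : i ∈ S generalizing S S'
  · have hi' : i ∈ S' := by
      by_contra hi'
      exact (h i).1 (iff_of_false hi hi') rfl
    have := this h.symm hi'
    tauto
  have hi' : i ∉ S' := fun hi' => (h i).1 (iff_of_true hi hi') rfl
  have : S = insert i S' := by
    ext j
    rw [Finset.mem_insert]
    by_cases hj : j = i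
    · subst hj; simp [hi]
    · simp [hj, (h j).2 hj]
  rw [this, Finset.card_insert_of_notMem hi', Nat.odd_add_one]

/-- Colouring the topes of a simple arrangement by the parity of the number of positive signs. -/
noncomputable def IsSimple.parityColoring (hA : A.IsSimple) : A.topeGraph.Coloring Bool :=
  SimpleGraph.Coloring.mk (fun T => decide (Odd (A.patternsEquiv.symm T).1.card)) fun {T T'} h => by
    obtain ⟨i, hi⟩ := hA.exists_differAt_of_adj
      (S := A.patternsEquiv.symm T) (S' := A.patternsEquiv.symm T') (by simpa using h)
    have := hi.odd_card_iff
    simp only [ne_eq, decide_eq_decide]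
    tauto

/-- The colouring with the two colours exchanged. -/
def swapColoring (C : A.topeGraph.Coloring Bool) : A.topeGraph.Coloring Bool :=
  SimpleGraph.Coloring.mk (fun T => !C T) fun h h' => C.valid h (Bool.not_inj h')

theorem numTopes_swapColoring (C : A.topeGraph.Coloring Bool) (k : Bool) :
    A.numTopes (swapColoring C) k = A.numTopes C (!k) := by
  have : (swapColoring C).colorClass k = C.colorClass (!k) := by
    ext T
    change (!C T) = k ↔ C T = !k
    cases C T <;> cases k <;> simp
  rw [numTopes, numTopes, this]

end HyperplaneArrangement

/-! ### A simple arrangement from the moment curve -/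

/-- The value at `x` of the linear form `x ↦ ∑ x_j t ^ j`. -/
noncomputable def momentForm (d : ℕ) (t : ℝ) : EuclideanSpace ℝ (Fin d) →ₗ[ℝ] ℝ where
  toFun x := ∑ j : Fin d, x j * t ^ (j : ℕ)
  map_add' x y := by simp [add_mul, Finset.sum_add_distrib]
  map_smul' c x := by simp [Finset.mul_sum, mul_assoc]

section MomentForm

variable {d : ℕ} {ι : Type*} {t : ι → ℝ}

/-- A point `x` encodes a polynomial of degree less than `d`, so this is Lagrange interpolation. -/
theorem exists_momentForm_eq (ht : Function.Injective t) (S : Finset ι)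
    (hS : S.card ≤ d) (r : ι → ℝ) :
    ∃ x : EuclideanSpace ℝ (Fin d), ∀ i ∈ S, momentForm d (t i) x = r i := by
  classical
  refine ⟨WithLp.toLp 2 fun j => (Lagrange.interpolate S t r).coeff j, fun i hi => ?_⟩
  have h1 := Lagrange.eval_interpolate_at_node r ht.injOn hi
  have h2 : (Lagrange.interpolate S t r).degree < d :=
    (Lagrange.degree_interpolate_lt r ht.injOn).trans_le (mod_cast hS)
  have hd : 0 < d := (Finset.card_pos.2 ⟨i, hi⟩).trans_le hS
  have h3 : (Lagrange.interpolate S t r).natDegree < d := by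
    rcases eq_or_ne (Lagrange.interpolate S t r) 0 with h | h
    · rwa [h, Polynomial.natDegree_zero]
    · exact (Polynomial.natDegree_lt_iff_degree_lt h).2 h2
  rw [Polynomial.eval_eq_sum_range' h3] at h1
  rw [← h1, ← Fin.sum_univ_eq_sum_range fun j => (Lagrange.interpolate S t r).coeff j * t i ^ j]
  rfl

/-- The indexed nodes are distinct roots of a monic polynomial of degree `d`. -/
theorem card_le_of_momentForm_eq_pow (ht : Function.Injective t) (S : Finset ι)
    (x : EuclideanSpace ℝ (Fin d))
    (h : ∀ i ∈ S, momentForm d (t i) x = t i ^ d) : S.card ≤ d := by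
  classical
  by_contra! hcard
  set q : Polynomial ℝ := ∑ j : Fin d, Polynomial.C (x j) * Polynomial.X ^ (j : ℕ) with hq
  have hdeg : (Polynomial.X ^ d - q).degree = (d : WithBot ℕ) := by
    rw [Polynomial.degree_sub_eq_left_of_degree_lt] <;> rw [Polynomial.degree_X_pow]
    exact Polynomial.degree_sum_fin_lt _
  have h0 := Polynomial.eq_zero_of_natDegree_lt_card_of_eval_eq_zero' (Polynomial.X ^ d - q)
    (S.image t)
    (fun s hs => by
      obtain ⟨i, hi, rfl⟩ := Finset.mem_image.1 hs
      rw [Polynomial.eval_sub, Polynomial.eval_pow, Polynomial.eval_X, ← h i hi, hq,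
        Polynomial.eval_finsetSum, sub_eq_zero]
      simp [momentForm])
    (by rwa [Finset.card_image_of_injective _ ht, Polynomial.natDegree_eq_of_degree_eq_some hdeg])
  rw [h0, Polynomial.degree_zero] at hdeg
  exact absurd hdeg (by simp)

theorem finrank_iInf_ker_momentForm (ht : Function.Injective t) (S : Finset ι)
    (hS : S.card ≤ d) :
    Module.finrank ℝ (⨅ i ∈ S, LinearMap.ker (momentForm d (t i)) : Submodule ℝ _) + S.card =
      d := by
  classical
  let L : EuclideanSpace ℝ (Fin d) →ₗ[ℝ] (S → ℝ) := LinearMap.pi fun i => momentForm d (t i)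
  have hker : (⨅ i ∈ S, LinearMap.ker (momentForm d (t i))) = LinearMap.ker L := by
    rw [LinearMap.ker_pi, iInf_subtype]
  have hrange : LinearMap.range L = ⊤ := LinearMap.range_eq_top.2 fun y => by
    obtain ⟨x, hx⟩ := exists_momentForm_eq ht S hS fun i => if hi : i ∈ S then y ⟨i, hi⟩ else 0
    exact ⟨x, funext fun i => (hx i i.2).trans (dif_pos i.2)⟩
  have := L.finrank_range_add_finrank_ker
  rw [hrange, finrank_top, Module.finrank_fintype_fun_eq_card, Fintype.card_coe,
    finrank_euclideanSpace_fin] at this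
  rw [hker]
  omega

end MomentForm

theorem exists_isSimple {d : ℕ} (hd : 0 < d) (n : ℕ) :
    ∃ A : HyperplaneArrangement d n, A.IsSimple := by
  have ht : Function.Injective fun i : Fin n => ((i : ℕ) : ℝ) :=
    Nat.cast_injective.comp Fin.val_injective
  set t : Fin n → ℝ := fun i => ((i : ℕ) : ℝ)
  choose p hp using fun i : Fin n =>
    exists_momentForm_eq ht {i} (by simpa using Nat.succ_le_of_lt hd) fun i => t i ^ d
  simp only [Finset.mem_singleton, forall_eq] at hp
  let A : HyperplaneArrangement d n :=
    { hyperplane := fun i => AffineSubspace.mk' (p i) (LinearMap.ker (momentForm d (t i)))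
      nonempty := fun i => AffineSubspace.mk'_nonempty _ _
      finrank_direction := fun i => by
        have := finrank_iInf_ker_momentForm ht {i} (d := d) (by simpa using Nat.succ_le_of_lt hd)
        rw [AffineSubspace.direction_mk']
        rwa [Finset.card_singleton, Finset.iInf_singleton] at this }
  have hmem : ∀ i x, x ∈ A.hyperplane i ↔ momentForm d (t i) x = t i ^ d := fun i x => by
    change x ∈ AffineSubspace.mk' (p i) (LinearMap.ker (momentForm d (t i))) ↔ _
    rw [AffineSubspace.mem_mk', LinearMap.mem_ker, vsub_eq_sub, map_sub, hp, sub_eq_zero]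
  refine ⟨A, fun S hS => ?_, fun S hS => ?_⟩
  · obtain ⟨x, hx⟩ := exists_momentForm_eq ht S hS fun i => t i ^ d
    refine ⟨⟨x, by simpa [hmem] using hx⟩, ?_⟩
    have hdir : (⨅ i ∈ S, A.hyperplane i).direction =
        ⨅ i ∈ S, LinearMap.ker (momentForm d (t i)) := by
      rw [AffineSubspace.direction_iInf_of_mem _ x fun i => by
        simpa [AffineSubspace.mem_iInf_iff, hmem] using hx i]
      refine iInf_congr fun i => ?_
      rw [AffineSubspace.direction_iInf_of_mem _ x fun hi => (hmem i x).2 (hx i hi)]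
      exact iInf_congr fun hi => AffineSubspace.direction_mk' _ _
    rw [hdir]
    exact finrank_iInf_ker_momentForm ht S hS
  · refine Set.eq_empty_iff_forall_notMem.2 fun x hx => ?_
    have := card_le_of_momentForm_eq_pow ht S x fun i hi => (hmem i x).1 (Set.mem_iInter₂.1 hx i hi)
    omega

/-! ### The limit superior -/

open HyperplaneArrangement in
theorem one_le_supTopeRatio {d n : ℕ} (hd : Odd d) (hdn : d ≤ n) : 1 ≤ supTopeRatio d n := by
  obtain ⟨A, hA⟩ := exists_isSimple hd.pos n
  obtain ⟨C, hC⟩ : ∃ C : A.topeGraph.Coloring Bool, A.numTopes C false ≤ A.numTopes C true := by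
    rcases le_total (A.numTopes hA.parityColoring false) (A.numTopes hA.parityColoring true)
      with h | h
    · exact ⟨_, h⟩
    · exact ⟨swapColoring hA.parityColoring, by rwa [numTopes_swapColoring, numTopes_swapColoring]⟩
  have hpos : 0 < A.numTopes C false := by
    have := hA.choose_le_two_mul_numTopes hd C false
    have := Nat.choose_pos hdn
    omega
  refine le_iSup_of_le A (le_iSup_of_le hA (le_iSup_of_le C ?_))
  rw [ENNReal.le_div_iff_mul_le (by simp [hpos.ne']) (by simp), one_mul]
  exact_mod_cast hC

theorem limsup_supTopeRatio {d : ℕ} (hd : Odd d) :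
    Filter.limsup (fun n : ℕ => supTopeRatio d n) Filter.atTop = 1 := by
  have hlim : Filter.Tendsto (fun n : ℕ => supTopeRatio d n) Filter.atTop (nhds 1) := by
    refine tendsto_order.2 ⟨fun a ha => ?_, fun a ha => ?_⟩
    · filter_upwards [Filter.eventually_ge_atTop d] with n hn
      exact ha.trans_le (one_le_supTopeRatio hd hn)
    -- An intermediate `b` is finite even if `a = ⊤`, and turns the non-strict bound with `ε =
    -- b.toReal - 1` into a strict one.
    · obtain ⟨b, hb1, hba⟩ := exists_between ha
      have hbtop : b ≠ ⊤ := (hba.trans_le le_top).ne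
      have hb1' : 1 < b.toReal := by
        simpa using (ENNReal.toReal_lt_toReal ENNReal.one_ne_top hbtop).2 hb1
      obtain ⟨N, hN⟩ := exists_forall_numTopes_div_le hd (sub_pos.2 hb1')
      filter_upwards [Filter.eventually_ge_atTop N] with n hn
      refine lt_of_le_of_lt (iSup_le fun A => iSup_le fun hA => iSup_le fun C => ?_) hba
      obtain ⟨-, hpos, hle⟩ := hN n hn A hA C
      rw [add_sub_cancel] at hle
      rw [← ENNReal.ofReal_toReal hbtop]
      refine le_trans (le_of_eq ?_) (ENNReal.ofReal_le_ofReal hle)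
      rw [ENNReal.ofReal_div_of_pos (mod_cast hpos), ENNReal.ofReal_natCast, ENNReal.ofReal_natCast]
  exact hlim.limsup_eq

theorem theorem10 (d : ℕ) (hd : Odd d) :
    (∀ ε : ℝ, 0 < ε → ∃ N : ℕ, ∀ n : ℕ, N ≤ n →
      ∀ A : HyperplaneArrangement d n, A.IsSimple →
        ∀ C : A.topeGraph.Coloring Bool,
          A.topes.Finite ∧ 0 < A.numTopes C false ∧
            (A.numTopes C true : ℝ) / (A.numTopes C false : ℝ) ≤ 1 + ε) ∧
    Filter.limsup (fun n : ℕ => supTopeRatio d n) Filter.atTop = 1 :=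
  ⟨fun _ hε => exists_forall_numTopes_div_le hd hε, limsup_supTopeRatio hd⟩
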